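/- Let $\delta\in(0,1)$ and let \[ K_\delta=\left\{x+iy:\ x,y\in\mathbb{R},\ \frac{x^2}{(1+\delta)^2}+\frac{y^2}{(1-\delta)^2}\le 1\right\}. \] For a bounded linear operator $T$ on a complex Hilbert space $\mathcal H$ let $W(T)=\{\langle Tu,u\rangle: u\in\mathcal H,\ \|u\|=1\}$ be its numerical range. A bounded linear operator $X$ on a complex Hilbert space is called a Douglas–Paulsen operator with parameter $\delta$ if it is invertible, $\|X\|\le 1$ and $\|X^{-1}\|\le 1/\delta$. Let $\mathcal H$ be a finite-dimensional complex Hilbert space. (1) For every linear operator $T$ on $\mathcal H$, $W(T)\subseteq K_\delta$ if and only if there exists a Douglas–Paulsen operator $X$ with parameter $\delta$ on $\mathcal H\oplus\mathcal H$ such that $\mathcal H\oplus\{0\}$ is invariant under $X+\delta X^{-1}$ and $T$ is the restriction of $X+\delta X^{-1}$ to $\mathcal H\oplus\{0\}$ (identified with $\mathcal H$). (2) For every linear operator $T$ on $\mathcal H$, $W(T)\subseteq K_\delta$ if and only if there exist a Hilbert space $\mathcal K$ (of any dimension) containing $\mathcal H$, up to an isometric embedding, and a Douglas–Paulsen operator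 $X$ with parameter $\delta$ on $\mathcal K$ such that $\mathcal H$ is invariant under $X+\delta X^{-1}$ and $T$ is the restriction of $X+\delta X^{-1}$ to $\mathcal H$. (3) For every Douglas–Paulsen operator $X$ with parameter $\delta$ on $\mathcal H$, $W(X+\delta X^{-1})\subseteq K_\delta$. -/

import Mathlib

universe u v

namespace EllipseRange

/-- The numerical range `W(T) = {⟨T u, u⟩ : ‖u‖ = 1}`. (Mathlib's inner product is linear in the
second variable, so `⟨T u, u⟩` is `inner ℂ u (T u)`.) -/
def numericalRange {H : Type*} [NormedAddCommGroup H] [InnerProductSpace ℂ H]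
    (T : H →L[ℂ] H) : Set ℂ :=
  {z | ∃ x : H, ‖x‖ = 1 ∧ z = inner ℂ x (T x)}

/-- The closed elliptical set `K_δ = {x + iy : x² / (1 + δ)² + y² / (1 - δ)² ≤ 1}`. -/
def ellipse (δ : ℝ) : Set ℂ :=
  {z | z.re ^ 2 / (1 + δ) ^ 2 + z.im ^ 2 / (1 - δ) ^ 2 ≤ 1}

/-- `X` is a Douglas-Paulsen operator with parameter `δ`: it is invertible, `‖X‖ ≤ 1` and
`‖X⁻¹‖ ≤ 1 / δ`. -/
def IsDouglasPaulsen {K : Type*} [NormedAddCommGroup K] [InnerProductSpace ℂ K]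
    (δ : ℝ) (X : K →L[ℂ] K) : Prop :=
  IsUnit X ∧ ‖X‖ ≤ 1 ∧ ‖Ring.inverse X‖ ≤ 1 / δ

/-- The operator `X + δ X⁻¹` (meaningful for invertible `X`). -/
noncomputable def joukowski {K : Type*} [NormedAddCommGroup K] [InnerProductSpace ℂ K]
    (δ : ℝ) (X : K →L[ℂ] K) : K →L[ℂ] K :=
  X + (δ : ℂ) • Ring.inverse X

/-- `H` being viewed as a subspace of `K` through the isometry `ι`, it is invariant under `A`
and `T` is the restriction of `A` to it. -/
def IsRestriction {H K : Type*} [NormedAddCommGroup H] [InnerProductSpace ℂ H]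
    [NormedAddCommGroup K] [InnerProductSpace ℂ K]
    (ι : H →ₗᵢ[ℂ] K) (T : H →L[ℂ] H) (A : K →L[ℂ] K) : Prop :=
  (∀ y ∈ Set.range ι, A y ∈ Set.range ι) ∧ ∀ x : H, A (ι x) = ι (T x)

/-- The embedding `x ↦ (x, 0)` of `H` onto the subspace `H ⊕ {0}` of the Hilbert space direct
sum `H ⊕ H`. -/
noncomputable def inl (H : Type*) [NormedAddCommGroup H] [InnerProductSpace ℂ H] :
    H →ₗᵢ[ℂ] WithLp 2 (H × H) where
  toFun x := WithLp.toLp 2 (x, 0)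
  map_add' x y := by apply WithLp.ofLp_injective; simp
  map_smul' c x := by apply WithLp.ofLp_injective; simp
  norm_map' x := by simp

end EllipseRange

/-! Everything rests on one reformulation: `z ∈ K_δ` iff `|z - δ z̄| ≤ 1 - δ²`. Numerical ranges
shrink under restriction, so two facts suffice.

`numericalRange_joukowski_subset`: let `X = U P` be the polar decomposition and `N = δ P⁻¹`. Then `X
+ δ X⁻¹ = U P + N U⋆` with `0 ≤ P, N ≤ 1` and `P N = δ`. For a unit vector `x` and `u = U⋆ x`, the
quantity `z - δ z̄` becomes `⟨u, Q x⟩ + ⟨x, R u⟩` with `Q = P - δ N ≥ 0`, `R = N - δ P ≥ 0` and `Q +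
R ≤ 1 - δ²`, and Cauchy–Schwarz bounds it.

`exists_douglasPaulsen_dilation`: if `W(T) ⊆ K_δ`, then `B = (T - δ T⋆) / (1 - δ²)` has numerical
radius at most 1 and `T = B + δ B⋆`. Ando's theorem (`mem_andoSet`) gives `B = 2 c W s`, with `W`
unitary, `c`, `s` commuting and self-adjoint, and `c² + s² = 1`. An explicit product of two block
reflections around `diag(W, δ W⋆)` is then the required `X`.

Ando's factorization comes from a positive solution of `G = 1 - B⋆ G⁻¹ B / 4`, obtained as a limit
of Schur complements of a positive block Toeplitz form. -/

namespace EllipseRange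

/-! ### Polar decomposition and order estimates in C⋆-algebras. -/

section CStar

variable {A : Type*} [CStarAlgebra A] [PartialOrder A] [StarOrderedRing A]

theorem isUnit_abs {X : A} (hX : IsUnit X) : IsUnit (CFC.abs X) := by
  have h : IsUnit (CFC.abs X * CFC.abs X) := by
    rw [CFC.abs_mul_abs]; exact hX.star.mul hX
  exact ((Commute.refl (CFC.abs X)).isUnit_mul_iff.mp h).1

/-- Polar decomposition of an invertible element of a C⋆-algebra. -/
theorem exists_unitary_mul_abs {X : A} (hX : IsUnit X) :
    ∃ U : A, star U * U = 1 ∧ U * star U = 1 ∧ X = U * CFC.abs X := by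
  obtain ⟨p, hp⟩ := isUnit_abs hX
  have hsa : star (p : A) = p := by
    rw [hp]; exact (CFC.abs_nonneg X).isSelfAdjoint
  have hinv : star (↑p⁻¹ : A) = ↑p⁻¹ := by
    have := Units.coe_star_inv p
    have h2 : star p = p := Units.ext hsa
    rw [← this, h2]
  have h1 : star (X * ↑p⁻¹) * (X * ↑p⁻¹) = 1 := by
    rw [star_mul, hinv, mul_assoc, ← mul_assoc (star X), ← CFC.abs_mul_abs, ← hp]
    simp
  have hu : IsUnit (X * ↑p⁻¹) := hX.mul p⁻¹.isUnit
  refine ⟨X * ↑p⁻¹, h1, ?_, ?_⟩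
  · obtain ⟨u, hu⟩ := hu
    rw [← hu] at h1 ⊢
    rw [← Units.inv_eq_of_mul_eq_one_left h1]; simp
  · rw [← hp]; simp [mul_assoc]

/-- All factors commute, so the bounds come from `M (1 - N²) = M - δ N ≥ 0`, its mirror image, and
`(1 - δ) (1 - M) (1 - N) ≥ 0`. Used with `M = |X|`, `N = δ |X|⁻¹`. -/
theorem unitary_factor_bounds {M N : A} {δ : ℝ} (hδ1 : δ ≤ 1)
    (hM0 : 0 ≤ M) (hM1 : M ≤ 1) (hN0 : 0 ≤ N) (hN1 : N ≤ 1)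
    (hMN : M * N = (δ : ℂ) • (1 : A)) (hNM : N * M = (δ : ℂ) • (1 : A)) :
    0 ≤ M - (δ : ℂ) • N ∧ 0 ≤ N - (δ : ℂ) • M ∧
      (M - (δ : ℂ) • N) + (N - (δ : ℂ) • M) ≤ ((1 - δ ^ 2 : ℝ) : ℂ) • (1 : A) := by
  have key : ∀ a b : A, 0 ≤ a → 0 ≤ b → b ≤ 1 → a * b = (δ : ℂ) • (1 : A) →
      b * a = (δ : ℂ) • (1 : A) → 0 ≤ a - (δ : ℂ) • b := by
    intro a b ha hb hb1 hab hba
    have hc : Commute a b := by rw [Commute, SemiconjBy, hab, hba]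
    have h1 : 0 ≤ (1 - b) * (1 + b) :=
      Commute.mul_nonneg (sub_nonneg.mpr hb1) (add_nonneg zero_le_one hb)
        (by rw [Commute, SemiconjBy]; noncomm_ring)
    have h2 : 0 ≤ a * ((1 - b) * (1 + b)) :=
      Commute.mul_nonneg ha h1
        (((Commute.one_right a).sub_right hc).mul_right ((Commute.one_right a).add_right hc))
    have h3 : a * ((1 - b) * (1 + b)) = a - (δ : ℂ) • b := by
      have : a * ((1 - b) * (1 + b)) = a - (a * b) * b := by noncomm_ring
      rw [this, hab, smul_mul_assoc, one_mul]
    rwa [h3] at h2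
  refine ⟨key M N hM0 hN0 hN1 hMN hNM, key N M hN0 hM0 hM1 hNM hMN, ?_⟩
  have hc : Commute M N := by rw [Commute, SemiconjBy, hMN, hNM]
  have h1 : 0 ≤ (1 - M) * (1 - N) :=
    Commute.mul_nonneg (sub_nonneg.mpr hM1) (sub_nonneg.mpr hN1)
      (((Commute.one_right _).sub_right ((Commute.one_left N).sub_left hc)))
  have h2 : (1 - M) * (1 - N) = 1 - M - N + (δ : ℂ) • (1 : A) := by
    rw [← hMN]; noncomm_ring
  have h3 : 0 ≤ (1 - δ) • ((1 - M) * (1 - N)) := smul_nonneg (by linarith) h1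
  rw [← sub_nonneg]
  convert h3 using 1
  rw [h2, ← Complex.coe_smul]
  push_cast
  module

end CStar

/-! ### The numerical range of `X + δ X⁻¹` lies in the ellipse. -/

section Op

variable {K : Type*} [NormedAddCommGroup K] [InnerProductSpace ℂ K] [CompleteSpace K]

open ContinuousLinearMap

theorem norm_inner_le_of_nonneg {Q : K →L[ℂ] K} (hQ : 0 ≤ Q) (u x : K) :
    ‖inner ℂ u (Q x)‖ ≤ ((inner ℂ u (Q u)).re + (inner ℂ x (Q x)).re) / 2 := by
  set S := CFC.sqrt Q with hS
  have hSS : S * S = Q := CFC.sqrt_mul_sqrt_self Q hQ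
  have hSa : ∀ a b : K, inner ℂ a (Q b) = inner ℂ (S a) (S b) := by
    intro a b
    have h : IsSelfAdjoint S := (CFC.sqrt_nonneg Q).isSelfAdjoint
    rw [← hSS, mul_apply_eq_comp, ← adjoint_inner_left, h.adjoint_eq]
  rw [hSa, hSa, hSa]
  have h1 := norm_inner_le_norm (𝕜 := ℂ) (S u) (S x)
  have h2 : ∀ a : K, (inner ℂ a a).re = ‖a‖ ^ 2 := fun a => by
    rw [inner_self_eq_norm_sq_to_K]; norm_cast
  rw [h2, h2]
  nlinarith [sq_nonneg (‖S u‖ - ‖S x‖)]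

/-- For `z = x + iy` one has `z - δ z̄ = (1 - δ) x + i (1 + δ) y`, so the hypothesis is the ellipse
inequality with denominators cleared. -/
theorem mem_ellipse_of_norm_le {δ : ℝ} (hδ0 : 0 < δ) (hδ1 : δ < 1) {z : ℂ}
    (h : ‖z - δ * (starRingEnd ℂ) z‖ ≤ 1 - δ ^ 2) : z ∈ ellipse δ := by
  have h2 : ‖z - δ * (starRingEnd ℂ) z‖ ^ 2 ≤ (1 - δ ^ 2) ^ 2 := by gcongr
  rw [← Complex.normSq_eq_norm_sq, Complex.normSq_apply] at h2
  simp at h2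
  have h3 : 0 < 1 - δ := by linarith
  have h4 : 0 < 1 + δ := by linarith
  simp only [ellipse, Set.mem_ofPred_eq]
  rw [div_add_div _ _ (by positivity) (by positivity), div_le_one (by positivity)]
  nlinarith [h2]

theorem norm_le_of_mem_ellipse {δ : ℝ} (hδ0 : 0 < δ) (hδ1 : δ < 1) {z : ℂ}
    (h : z ∈ ellipse δ) : ‖z - δ * (starRingEnd ℂ) z‖ ≤ 1 - δ ^ 2 := by
  have h3 : 0 < 1 - δ := by linarith
  have h4 : 0 < 1 + δ := by linarith
  have h5 : 0 ≤ 1 - δ ^ 2 := by nlinarith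
  refine le_of_sq_le_sq ?_ h5
  rw [← Complex.normSq_eq_norm_sq, Complex.normSq_apply]
  simp only [ellipse, Set.mem_ofPred_eq] at h
  rw [div_add_div _ _ (by positivity) (by positivity), div_le_one (by positivity)] at h
  simp
  nlinarith [h]

theorem inverse_eq_of_mul_eq_one {R : Type*} [Ring R] {a b : R} (h : a * b = 1) (h' : b * a = 1) :
    Ring.inverse a = b :=
  Ring.inverse_unit (⟨a, b, h, h'⟩ : Rˣ)

theorem norm_le_one_of_star_mul_self {U : K →L[ℂ] K} (hU : star U * U = 1) : ‖U‖ ≤ 1 := by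
  have h : ‖U‖ * ‖U‖ ≤ 1 := by
    rw [← CStarRing.norm_star_mul_self, hU]; exact norm_id_le
  nlinarith [norm_nonneg U]

theorem numericalRange_joukowski_subset {δ : ℝ} (hδ0 : 0 < δ) (hδ1 : δ < 1) {X : K →L[ℂ] K}
    (hX : IsDouglasPaulsen δ X) : numericalRange (joukowski δ X) ⊆ ellipse δ := by
  obtain ⟨hu, hn, hi⟩ := hX
  obtain ⟨U, hU1, hU2, hXU⟩ := exists_unitary_mul_abs hu
  obtain ⟨P, S, hP0, hS0, hPS, hSP, hPX⟩ : ∃ P S : K →L[ℂ] K, 0 ≤ P ∧ 0 ≤ S ∧ P * S = 1 ∧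
      S * P = 1 ∧ CFC.abs X = P := by
    obtain ⟨p, hp⟩ := isUnit_abs hu
    have hp0 : 0 ≤ (p : K →L[ℂ] K) := hp ▸ CFC.abs_nonneg X
    exact ⟨p, ↑p⁻¹, hp0, CFC.inv_nonneg_of_nonneg p hp0, by simp, by simp, hp.symm⟩
  rw [hPX] at hXU
  have hP1 : P ≤ 1 := by
    rw [← CStarAlgebra.norm_le_one_iff_of_nonneg _ hP0, ← hPX, CFC.norm_abs]; exact hn
  have hinv : Ring.inverse X = S * star U := by
    apply inverse_eq_of_mul_eq_one
    · rw [hXU, mul_assoc, ← mul_assoc P, hPS, one_mul, hU2]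
    · rw [hXU, mul_assoc, ← mul_assoc (star U), hU1, one_mul, hSP]
  have hSU : S = Ring.inverse X * U := by
    rw [hinv, mul_assoc, hU1, mul_one]
  have hnU : ‖U‖ ≤ 1 := norm_le_one_of_star_mul_self hU1
  set N : K →L[ℂ] K := (δ : ℂ) • S with hN
  have hN0 : 0 ≤ N := by
    rw [hN, Complex.coe_smul]; exact smul_nonneg hδ0.le hS0
  have hN1 : N ≤ 1 := by
    rw [← CStarAlgebra.norm_le_one_iff_of_nonneg _ hN0, hN, norm_smul, hSU]
    calc ‖(δ : ℂ)‖ * ‖Ring.inverse X * U‖ ≤ δ * (1 / δ * 1) := by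
          rw [Complex.norm_real, Real.norm_of_nonneg hδ0.le]
          gcongr
          exact (norm_mul_le _ _).trans (by gcongr)
      _ = 1 := by field_simp
  obtain ⟨hQ, hR, hQR⟩ := unitary_factor_bounds hδ1.le hP0 hP1 hN0 hN1
    (by rw [hN, mul_smul_comm, hPS]) (by rw [hN, smul_mul_assoc, hSP])
  set Q := P - (δ : ℂ) • N with hQd
  set R := N - (δ : ℂ) • P with hRd
  rintro z ⟨x, hx, rfl⟩
  apply mem_ellipse_of_norm_le hδ0 hδ1
  set u := star U x with hud
  have hadj : ∀ a : K, inner ℂ x (U a) = inner ℂ u a := by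
    intro a; rw [hud, star_eq_adjoint, adjoint_inner_left]
  have hun : ‖u‖ = 1 := by
    have h1 : U u = x := by
      rw [hud, ← mul_apply_eq_comp, hU2, one_apply_eq_self]
    have h2 := hadj u
    rw [h1, inner_self_eq_norm_sq_to_K, inner_self_eq_norm_sq_to_K, hx] at h2
    have h3 : ‖u‖ ^ 2 = 1 ^ 2 := by exact_mod_cast h2.symm
    nlinarith [norm_nonneg u]
  have hAx : joukowski δ X x = U (P x) + N u := by
    rw [joukowski, hinv, hud]; nth_rw 1 [hXU]; rw [hN]; simp
  have hsym : ∀ (S : K →L[ℂ] K), 0 ≤ S → ∀ a b,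
      (starRingEnd ℂ) (inner ℂ a (S b)) = inner ℂ b (S a) := by
    intro S hS a b
    rw [inner_conj_symm, ← adjoint_inner_right, hS.isSelfAdjoint.adjoint_eq]
  -- Conjugation exchanges the roles of `u` and `x`, so `-δ z̄` turns `P` into `P - δ N` and `N`
  -- into `N - δ P`.
  have hz : inner ℂ x (joukowski δ X x) - δ * (starRingEnd ℂ) (inner ℂ x (joukowski δ X x))
      = inner ℂ u (Q x) + inner ℂ x (R u) := by
    rw [hAx, inner_add_right, hadj, map_add, hsym _ hP0, hsym _ hN0, hQd, hRd]
    simp only [sub_apply, inner_sub_right, smul_apply, inner_smul_right]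
    ring
  have hb : ∀ a : K, ‖a‖ = 1 → (inner ℂ a (Q a)).re + (inner ℂ a (R a)).re ≤ 1 - δ ^ 2 := by
    intro a ha
    have := ((le_def _ _).mp hQR).re_inner_nonneg_right a
    rw [sub_apply, add_apply, inner_sub_right, inner_add_right, smul_apply, inner_smul_right,
      one_apply_eq_self, inner_self_eq_norm_sq_to_K, ha] at this
    simp only [map_sub, map_add, RCLike.re_eq_complex_re, Complex.re_ofReal_mul] at this
    simp at this
    linarith
  rw [hz]
  have h1 := norm_inner_le_of_nonneg hQ u x
  have h2 := norm_inner_le_of_nonneg hR x u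
  have h3 := hb x hx
  have h4 := hb u hun
  calc _ ≤ _ := norm_add_le _ _
    _ ≤ _ := by linarith

end Op

/-! ### Positivity of a block Toeplitz form by discrete Fourier analysis. -/

section Fejer

open Finset

theorem sum_conj_root_pow {N : ℕ} {ω : ℂ} (hω : IsPrimitiveRoot ω N) (hN : N ≠ 0) {l m : ℕ}
    (hl : l < N) (hm : m < N) :
    ∑ j ∈ range N, (starRingEnd ℂ) ((ω ^ j) ^ l) * (ω ^ j) ^ m = if l = m then (N : ℂ) else 0 := by
  have hω1 : ‖ω‖ = 1 := hω.norm'_eq_one hN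
  have hc : (starRingEnd ℂ) ω * ω = 1 := by
    rw [mul_comm, Complex.mul_conj, Complex.normSq_eq_norm_sq, hω1]; simp
  set ζ := (starRingEnd ℂ) ω ^ l * ω ^ m with hζ
  have h1 : ∀ j, (starRingEnd ℂ) ((ω ^ j) ^ l) * (ω ^ j) ^ m = ζ ^ j := by
    intro j
    rw [hζ, map_pow, map_pow, mul_pow, ← pow_mul, ← pow_mul, ← pow_mul, ← pow_mul, mul_comm j l,
      mul_comm j m]
  simp_rw [h1]
  split_ifs with h
  · have : ζ = 1 := by rw [hζ, h, ← mul_pow, hc, one_pow]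
    simp [this]
  · have hz : ζ ≠ 1 := by
      intro hz
      apply h
      apply hω.pow_inj hl hm
      calc ω ^ l = ω ^ l * ζ := by rw [hz, mul_one]
        _ = ((starRingEnd ℂ) ω * ω) ^ l * ω ^ m := by rw [hζ, mul_pow]; ring
        _ = ω ^ m := by rw [hc, one_pow, one_mul]
    have hN1 : ζ ^ N = 1 := by
      rw [hζ, mul_pow, ← pow_mul, ← pow_mul, mul_comm l, mul_comm m, pow_mul, pow_mul, ← map_pow,
        hω.pow_eq_one]
      simp
    have := mul_geom_sum ζ N
    rw [hN1, sub_self] at this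
    exact (mul_eq_zero.mp this).resolve_left (sub_ne_zero.mpr hz)

variable {H : Type*} [NormedAddCommGroup H] [InnerProductSpace ℂ H]

/-- The weight `(ω ^ j) ^ s` selects the `s`-th block diagonal. The condition `n + s ≤ N` keeps all
exponents below `N`, which rules out aliasing. Shift 1 yields the off-diagonal part of the Toeplitz
form; shift 0 with the identity is Parseval. -/
theorem sum_root_inner {N : ℕ} {ω : ℂ} (hω : IsPrimitiveRoot ω N) (hN : N ≠ 0)
    (B : H →L[ℂ] H) (x : ℕ → H) {n s : ℕ} (hn : n + s ≤ N) :
    ∑ j ∈ range N, (ω ^ j) ^ s * inner ℂ (∑ l ∈ range n, (ω ^ j) ^ l • x l)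
        (B (∑ k ∈ range n, (ω ^ j) ^ k • x k)) =
      N * ∑ k ∈ range n, if k + s < n then inner ℂ (x (k + s)) (B (x k)) else 0 := by
  have h1 : ∀ j, (ω ^ j) ^ s * inner ℂ (∑ l ∈ range n, (ω ^ j) ^ l • x l)
        (B (∑ k ∈ range n, (ω ^ j) ^ k • x k)) = ∑ k ∈ range n, ∑ l ∈ range n,
        ((starRingEnd ℂ) ((ω ^ j) ^ l) * (ω ^ j) ^ (k + s)) * inner ℂ (x l) (B (x k)) := by
    intro j
    simp only [map_sum, map_smul, sum_inner, inner_sum, inner_smul_left, inner_smul_right,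
      mul_sum]
    refine sum_congr rfl fun k _ => sum_congr rfl fun l _ => ?_
    rw [pow_add]; ring
  simp_rw [h1]
  rw [sum_comm, mul_sum]
  refine sum_congr rfl fun k hk => ?_
  rw [sum_comm]
  simp_rw [← sum_mul]
  have hk' := mem_range.mp hk
  rw [sum_congr rfl fun l hl => by
    rw [sum_conj_root_pow hω hN (l := l) (m := k + s) (by have := mem_range.mp hl; omega) (by omega)]]
  simp only [ite_mul, zero_mul, sum_ite_eq', mem_range, mul_ite, mul_zero]

/-- Positivity of the block tridiagonal Toeplitz form attached to an operator whose numerical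
radius is at most `r`. -/
theorem toeplitz_form_ge {B : H →L[ℂ] H} {r : ℝ} (hB : ∀ x, ‖inner ℂ x (B x)‖ ≤ r * ‖x‖ ^ 2)
    (x : ℕ → H) (n : ℕ) :
    -(∑ k ∈ range n, inner ℂ (x (k + 1)) (B (x k))).re ≤ r * ∑ k ∈ range (n + 1), ‖x k‖ ^ 2 := by
  -- There are `n + 1` vectors and the largest shift is 1.
  set N := n + 2 with hN
  have hω := Complex.isPrimitiveRoot_exp N (by omega)
  set ω := Complex.exp (2 * Real.pi * Complex.I / N)
  have hω1 : ‖ω‖ = 1 := hω.norm'_eq_one (by omega)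
  have h1 := sum_root_inner hω (by omega) B x (n := n + 1) (s := 1) (by omega)
  have h0 := sum_root_inner hω (by omega) (ContinuousLinearMap.id ℂ H) x (n := n + 1) (s := 0)
    (by omega)
  set F : ℕ → H := fun j => ∑ l ∈ range (n + 1), (ω ^ j) ^ l • x l with hF
  have e1 : ∑ k ∈ range (n + 1), (if k + 1 < n + 1 then inner ℂ (x (k + 1)) (B (x k)) else 0) =
      ∑ k ∈ range n, inner ℂ (x (k + 1)) (B (x k)) := by
    rw [sum_range_succ, if_neg (by omega), add_zero]
    exact sum_congr rfl fun k hk => if_pos (by have := mem_range.mp hk; omega)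
  rw [e1] at h1
  have e0 : ∑ j ∈ range N, ‖F j‖ ^ 2 = N * ∑ k ∈ range (n + 1), ‖x k‖ ^ 2 := by
    have e2 : ∑ k ∈ range (n + 1), (if k + 0 < n + 1 then
        inner ℂ (x (k + 0)) (ContinuousLinearMap.id ℂ H (x k)) else 0) =
        ((∑ k ∈ range (n + 1), ‖x k‖ ^ 2 : ℝ) : ℂ) := by
      push_cast
      refine sum_congr rfl fun k hk => ?_
      rw [if_pos (by have := mem_range.mp hk; omega)]
      exact inner_self_eq_norm_sq_to_K _
    rw [e2] at h0
    have e3 : ∑ j ∈ range N, (ω ^ j) ^ 0 * inner ℂ (F j) (ContinuousLinearMap.id ℂ H (F j)) =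
        ((∑ j ∈ range N, ‖F j‖ ^ 2 : ℝ) : ℂ) := by
      push_cast
      refine sum_congr rfl fun k hk => ?_
      rw [pow_zero, one_mul]
      exact inner_self_eq_norm_sq_to_K _
    rw [e3] at h0
    exact_mod_cast h0
  have h2 : ‖(N : ℂ) * ∑ k ∈ range n, inner ℂ (x (k + 1)) (B (x k))‖ ≤
      N * (r * ∑ k ∈ range (n + 1), ‖x k‖ ^ 2) := by
    rw [← h1]
    calc _ ≤ ∑ j ∈ range N, r * ‖F j‖ ^ 2 := by
          refine norm_sum_le_of_le _ fun j _ => ?_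
          rw [norm_mul, norm_pow, norm_pow, hω1, one_pow, one_pow, one_mul]
          exact hB (F j)
      _ = _ := by rw [← mul_sum, e0]; ring
  rw [norm_mul, Complex.norm_natCast] at h2
  have h3 := le_of_mul_le_mul_left h2 (by positivity)
  have h4 := Complex.abs_re_le_norm (∑ k ∈ range n, inner ℂ (x (k + 1)) (B (x k)))
  have := neg_abs_le (∑ k ∈ range n, inner ℂ (x (k + 1)) (B (x k))).re
  linarith

end Fejer

/-! ### A positive fixed point of the Schur complement map. -/

section Riccati

open Finset ContinuousLinearMap

variable {H : Type*} [NormedAddCommGroup H] [InnerProductSpace ℂ H] [CompleteSpace H]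

/-- The Schur complement map `G ↦ 1 - B⋆ G⁻¹ B / 4`. -/
noncomputable def schurStep (B G : H →L[ℂ] H) : H →L[ℂ] H :=
  1 - (1 / 4 : ℝ) • (star B * Ring.inverse G * B)

/-- The successive Schur complements of the block tridiagonal Toeplitz form of `B`. -/
noncomputable def schurSeq (B : H →L[ℂ] H) : ℕ → H →L[ℂ] H
  | 0 => 1
  | n + 1 => schurStep B (schurSeq B n)

theorem schurStep_isSelfAdjoint {B G : H →L[ℂ] H} (hG : IsStrictlyPositive G) :
    IsSelfAdjoint (schurStep B G) := by
  have h : IsSelfAdjoint (Ring.inverse G) := hG.isSelfAdjoint.ringInverse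
  have h2 : star (star B * Ring.inverse G * B) = star B * Ring.inverse G * B := h.conjugate' B
  rw [IsSelfAdjoint, schurStep, star_sub, star_one, star_smul, h2, star_trivial]

theorem smul_one_le_of_forall {G : H →L[ℂ] H} (hG : IsSelfAdjoint G) {c : ℝ}
    (h : ∀ x, c * ‖x‖ ^ 2 ≤ (inner ℂ x (G x)).re) : c • (1 : H →L[ℂ] H) ≤ G := by
  rw [le_def, isPositive_def']
  constructor
  · rw [IsSelfAdjoint, star_sub, star_smul, star_one, hG.star_eq, star_trivial]
  intro x
  rw [reApplyInnerSelf_apply, inner_re_symm]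
  have h1 := h x
  have h2 : inner ℂ x x = ((‖x‖ ^ 2 : ℝ) : ℂ) := by
    rw [inner_self_eq_norm_sq_to_K]; norm_cast
  have h3 : (c • (1 : H →L[ℂ] H)) x = (c : ℂ) • x := by simp
  rw [sub_apply, inner_sub_right, h3, inner_smul_right, h2, map_sub, RCLike.re_eq_complex_re,
    ← Complex.ofReal_mul, Complex.ofReal_re]
  linarith

theorem isStrictlyPositive_of_smul_one_le {G : H →L[ℂ] H} {c : ℝ} (hc : 0 < c)
    (h : c • (1 : H →L[ℂ] H) ≤ G) : IsStrictlyPositive G :=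
  IsStrictlyPositive.of_le (IsStrictlyPositive.smul hc isStrictlyPositive_one) h

/-- The quadratic form of the `n`-th Schur complement at `x` is a value of the Toeplitz form with
first vector `x`. That form is at least `(1 - r) ∑ ‖y k‖²`, whence the uniform lower bound. The two
claims need a joint induction: the bound at `n` makes the inverse in the next step meaningful. -/
theorem schurSeq_spec {B : H →L[ℂ] H} {r : ℝ} (hr : r < 1)
    (hB : ∀ x, ‖inner ℂ x (B x)‖ ≤ r * ‖x‖ ^ 2) (n : ℕ) :
    (1 - r) • (1 : H →L[ℂ] H) ≤ schurSeq B n ∧ ∀ x, ∃ y : ℕ → H, y 0 = x ∧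
      ∑ k ∈ range (n + 1), ‖y k‖ ^ 2 + (∑ k ∈ range n, inner ℂ (y (k + 1)) (B (y k))).re =
        (inner ℂ x (schurSeq B n x)).re := by
  have lower : ∀ n, IsSelfAdjoint (schurSeq B n) → (∀ x, ∃ y : ℕ → H, y 0 = x ∧
      ∑ k ∈ range (n + 1), ‖y k‖ ^ 2 + (∑ k ∈ range n, inner ℂ (y (k + 1)) (B (y k))).re =
        (inner ℂ x (schurSeq B n x)).re) → (1 - r) • (1 : H →L[ℂ] H) ≤ schurSeq B n := by
    intro n hsa h
    refine smul_one_le_of_forall hsa fun x => ?_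
    obtain ⟨y, hy0, hy⟩ := h x
    rw [← hy]
    have h1 := toeplitz_form_ge hB y n
    have h2 : ‖x‖ ^ 2 ≤ ∑ k ∈ range (n + 1), ‖y k‖ ^ 2 := by
      rw [← hy0]
      exact single_le_sum (f := fun k => ‖y k‖ ^ 2) (fun _ _ => by positivity) (by simp)
    nlinarith
  induction n with
  | zero =>
    have h : ∀ x, ∃ y : ℕ → H, y 0 = x ∧
      ∑ k ∈ range (0 + 1), ‖y k‖ ^ 2 + (∑ k ∈ range 0, inner ℂ (y (k + 1)) (B (y k))).re =
        (inner ℂ x (schurSeq B 0 x)).re := by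
      intro x
      refine ⟨fun _ => x, rfl, ?_⟩
      simp only [schurSeq, one_apply_eq_self, inner_self_eq_norm_sq_to_K]
      simp [← Complex.ofReal_pow]
    exact ⟨lower 0 (IsSelfAdjoint.one _) h, h⟩
  | succ n ih =>
    obtain ⟨hG, ih⟩ := ih
    set G := schurSeq B n with hGdef
    have hpos : IsStrictlyPositive G := isStrictlyPositive_of_smul_one_le (by linarith) hG
    have h : ∀ x, ∃ y : ℕ → H, y 0 = x ∧
      ∑ k ∈ range (n + 1 + 1), ‖y k‖ ^ 2 +
        (∑ k ∈ range (n + 1), inner ℂ (y (k + 1)) (B (y k))).re =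
        (inner ℂ x (schurSeq B (n + 1) x)).re := by
      intro x
      set z := Ring.inverse G (B x) with hz
      -- The vector `w = -G⁻¹ B x / 2` minimizes `Re ⟨w, B x⟩ + ⟨w, G w⟩`; the minimum is `-⟨B x,
      -- G⁻¹ B x⟩ / 4`.
      obtain ⟨y, hy0, hy⟩ := ih (-(1 / 2 : ℂ) • z)
      refine ⟨fun k => Nat.casesOn k x y, rfl, ?_⟩
      rw [sum_range_succ', sum_range_succ' (fun k => inner ℂ _ _)]
      dsimp only
      have hGz : G z = B x := by
        rw [hz, ← mul_apply_eq_comp, Ring.mul_inverse_cancel _ hpos.isUnit, one_apply_eq_self]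
      have hstep : inner ℂ x (schurSeq B (n + 1) x) = inner ℂ x x - (1 / 4 : ℂ) * inner ℂ (B x) z := by
        have : schurSeq B (n + 1) x = x - (1 / 4 : ℂ) • (star B) z := by
          simp [schurSeq, schurStep, hz, hGdef, ← Complex.coe_smul]
        rw [this, inner_sub_right, inner_smul_right, star_eq_adjoint, adjoint_inner_right]
      have hsym : (inner ℂ (B x) z).re = (inner ℂ z (B x)).re := inner_re_symm (𝕜 := ℂ) _ _
      have hxx : (inner ℂ x x).re = ‖x‖ ^ 2 := by
        rw [inner_self_eq_norm_sq_to_K]; norm_cast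
      rw [hstep, hy0, Complex.add_re, Complex.sub_re, hxx]
      simp only [inner_smul_left, inner_smul_right, map_smul, hGz] at hy ⊢
      simp at hy ⊢
      linarith
    exact ⟨lower (n + 1) (schurStep_isSelfAdjoint hpos) h, h⟩

/-- Inversion reverses the order on strictly positive operators, so the Schur step preserves it, and
the first inequality propagates. -/
theorem schurSeq_succ_le {B : H →L[ℂ] H} {r : ℝ} (hr : r < 1)
    (hB : ∀ x, ‖inner ℂ x (B x)‖ ≤ r * ‖x‖ ^ 2) (n : ℕ) : schurSeq B (n + 1) ≤ schurSeq B n := by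
  have pos : ∀ n, IsStrictlyPositive (schurSeq B n) := fun n =>
    isStrictlyPositive_of_smul_one_le (by linarith) (schurSeq_spec hr hB n).1
  induction n with
  | zero =>
    simp only [schurSeq, schurStep, sub_le_self_iff]
    refine smul_nonneg (by norm_num) ?_
    simpa only [Ring.inverse_one, mul_one] using star_mul_self_nonneg B
  | succ n ih =>
    have h1 := CStarAlgebra.ringInverse_le_ringInverse ih (pos (n + 1))
    have h2 := star_left_conjugate_le_conjugate h1 B
    exact sub_le_sub_left (smul_le_smul_of_nonneg_left h2 (by norm_num)) 1

theorem exists_schurStep_fixed [FiniteDimensional ℂ H] {B : H →L[ℂ] H} {r : ℝ} (hr : r < 1)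
    (hB : ∀ x, ‖inner ℂ x (B x)‖ ≤ r * ‖x‖ ^ 2) :
    ∃ G, IsStrictlyPositive G ∧ schurStep B G = G := by
  have low := fun n => (schurSeq_spec hr hB n).1
  have pos : ∀ n, IsStrictlyPositive (schurSeq B n) := fun n =>
    isStrictlyPositive_of_smul_one_le (by linarith) (low n)
  have anti : Antitone (schurSeq B) := antitone_nat_of_succ_le (schurSeq_succ_le hr hB)
  have : ProperSpace (H →L[ℂ] H) := FiniteDimensional.proper ℂ _
  have hmem : ∀ n, schurSeq B n ∈ Metric.closedBall (0 : H →L[ℂ] H) 1 := by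
    intro n
    rw [mem_closedBall_zero_iff, CStarAlgebra.norm_le_one_iff_of_nonneg _ (pos n).nonneg]
    exact anti (Nat.zero_le n)
  obtain ⟨G, -, φ, hφ, hlim⟩ := (isCompact_closedBall (0 : H →L[ℂ] H) 1).tendsto_subseq hmem
  have hG : (1 - r) • (1 : H →L[ℂ] H) ≤ G := ge_of_tendsto' hlim fun k => low _
  have hpos : IsStrictlyPositive G := isStrictlyPositive_of_smul_one_le (by linarith) hG
  have hcont : ContinuousAt (schurStep B) G := by
    obtain ⟨u, hu⟩ := hpos.isUnit
    have h : ContinuousAt (Ring.inverse : (H →L[ℂ] H) → _) G := by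
      rw [← hu]; exact NormedRing.inverse_continuousAt u
    unfold schurStep
    have h2 : ContinuousAt (fun G => star B * Ring.inverse G * B) G :=
      (continuousAt_const.mul h).mul continuousAt_const
    exact continuousAt_const.sub (h2.const_smul (1 / 4 : ℝ))
  have hlim2 : Filter.Tendsto (fun k => schurSeq B (φ k + 1)) Filter.atTop
      (nhds (schurStep B G)) := hcont.tendsto.comp hlim
  refine ⟨G, hpos, le_antisymm ?_ ?_⟩
  · exact le_of_tendsto_of_tendsto' hlim2 hlim fun k => anti (Nat.le_succ _)
  · refine ge_of_tendsto' hlim2 fun k => ?_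
    -- Only a subsequence converges, but by monotonicity its late terms lie below the term of index
    -- `φ k + 1`, hence so does `G`.
    refine le_of_tendsto hlim (Filter.eventually_atTop.mpr ⟨φ k + 1, fun j hj => ?_⟩)
    exact anti (hj.trans (hφ.id_le j))

end Riccati

/-! ### The factorization `B = 2 c W s`: closedness and the invertible case. -/

section CStar

variable {A : Type*} [CStarAlgebra A]

/-- The elements of the form `2 c W s` with `W` unitary and `c`, `s` commuting self-adjoint
elements satisfying `c² + s² = 1`. -/
def andoSet (A : Type*) [CStarAlgebra A] : Set A :=
  {B | ∃ W c s : A, star W * W = 1 ∧ W * star W = 1 ∧ star c = c ∧ star s = s ∧ c * s = s * c ∧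
    c * c + s * s = 1 ∧ B = (2 : ℂ) • (c * W * s)}

theorem norm_le_one_of_star_mul_self_le [PartialOrder A] [StarOrderedRing A] {a : A}
    (h : star a * a ≤ 1) : ‖a‖ ≤ 1 := by
  have h1 := (CStarAlgebra.norm_le_one_iff_of_nonneg _ (star_mul_self_nonneg a)).mpr h
  rw [CStarRing.norm_star_mul_self] at h1
  nlinarith [norm_nonneg a]

/-- It is a continuous image of the set of triples `(W, c, s)`, which is compact because the
relations are closed and force norms at most 1. -/
theorem isClosed_andoSet [PartialOrder A] [StarOrderedRing A] [ProperSpace A] :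
    IsClosed (andoSet A) := by
  have hK : IsCompact {p : A × A × A | star p.1 * p.1 = 1 ∧ p.1 * star p.1 = 1 ∧
      star p.2.1 = p.2.1 ∧ star p.2.2 = p.2.2 ∧ p.2.1 * p.2.2 = p.2.2 * p.2.1 ∧
      p.2.1 * p.2.1 + p.2.2 * p.2.2 = 1} := by
    apply Metric.isCompact_of_isClosed_isBounded
    · refine (isClosed_eq (by fun_prop) (by fun_prop)).inter <|
        (isClosed_eq (by fun_prop) (by fun_prop)).inter <|
        (isClosed_eq (by fun_prop) (by fun_prop)).inter <|
        (isClosed_eq (by fun_prop) (by fun_prop)).inter <|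
        (isClosed_eq (by fun_prop) (by fun_prop)).inter
        (isClosed_eq (by fun_prop) (by fun_prop))
    · refine (Metric.isBounded_closedBall (x := (0 : A × A × A)) (r := 1)).subset ?_
      rintro ⟨W, c, s⟩ ⟨h1, -, hc, hs, -, h2⟩
      dsimp only at h1 hc hs h2
      rw [mem_closedBall_zero_iff, norm_prod_le_iff, norm_prod_le_iff]
      refine ⟨norm_le_one_of_star_mul_self_le h1.le, norm_le_one_of_star_mul_self_le ?_,
        norm_le_one_of_star_mul_self_le ?_⟩
      · dsimp only
        rw [hc, ← h2, le_add_iff_nonneg_right]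
        nth_rw 1 [← hs]; exact star_mul_self_nonneg s
      · dsimp only
        rw [hs, ← h2, le_add_iff_nonneg_left]
        nth_rw 1 [← hc]; exact star_mul_self_nonneg c
  have := (hK.image (f := fun p : A × A × A => (2 : ℂ) • (p.2.1 * p.1 * p.2.2))
    (by fun_prop)).isClosed
  convert this using 1
  ext B
  constructor
  · rintro ⟨W, c, s, h1, h2, h3, h4, h5, h6, rfl⟩
    exact ⟨(W, c, s), ⟨h1, h2, h3, h4, h5, h6⟩, rfl⟩
  · rintro ⟨⟨W, c, s⟩, ⟨h1, h2, h3, h4, h5, h6⟩, rfl⟩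
    exact ⟨W, c, s, h1, h2, h3, h4, h5, h6, rfl⟩

/-- With `c = √G` and `C = c⁻¹ B / 2`, the equation says `C⋆ C = 1 - G`. The polar decomposition `C
= W |C|` then gives `B = 2 c W |C|`, so `s = |C|`. -/
theorem mem_andoSet_of_isUnit [PartialOrder A] [StarOrderedRing A] {B G : A} (hB : IsUnit B)
    (hG : IsStrictlyPositive G) (h : 1 - (1 / 4 : ℝ) • (star B * Ring.inverse G * B) = G) :
    B ∈ andoSet A := by
  set c := CFC.sqrt G with hc
  have hcc : c * c = G := CFC.sqrt_mul_sqrt_self G hG.nonneg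
  have hcsa : star c = c := (CFC.sqrt_nonneg G).isSelfAdjoint
  obtain ⟨u, hu⟩ : IsUnit c := (CFC.isUnit_sqrt_iff G hG.nonneg).mpr hG.isUnit
  have hinv : Ring.inverse G = ↑u⁻¹ * ↑u⁻¹ := by
    rw [← hcc, ← hu, ← Units.val_mul, Ring.inverse_unit, mul_inv_rev, Units.val_mul]
  have husa : star (↑u⁻¹ : A) = ↑u⁻¹ := by
    rw [← Units.coe_star_inv, show star u = u from Units.ext (by rw [Units.coe_star, hu, hcsa])]
  set C := (1 / 2 : ℝ) • (↑u⁻¹ * B) with hC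
  have hCu : IsUnit C := by
    have : C = ((Units.mk0 (1 / 2 : ℝ) (by norm_num)) • (u⁻¹ * hB.unit) : Aˣ) := by
      simp [hC, Units.smul_def]
    rw [this]; exact Units.isUnit _
  obtain ⟨W, hW1, hW2, hCW⟩ := exists_unitary_mul_abs hCu
  have hss : CFC.abs C * CFC.abs C = 1 - G := by
    rw [CFC.abs_mul_abs, hC, star_smul, star_mul, husa, star_trivial, smul_mul_smul_comm]
    nth_rw 1 [← h]
    rw [hinv, sub_sub_cancel]
    norm_num [mul_assoc]
  -- Since `G = 1 - |C|²`, `|C|` commutes with `G` and therefore with `√G`.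
  have hcomm : Commute (CFC.abs C) G := by
    have : G = 1 - CFC.abs C * CFC.abs C := by rw [hss]; abel
    rw [this]
    exact (Commute.one_right _).sub_right ((Commute.refl _).mul_right (Commute.refl _))
  refine ⟨W, c, CFC.abs C, hW1, hW2, hcsa, (CFC.abs_nonneg C).isSelfAdjoint, ?_, ?_, ?_⟩
  · exact hcomm.symm.cfcₙ_nnreal _
  · rw [hcc, hss]; abel
  · rw [mul_assoc, ← hCW, hC, ← hu, mul_smul_comm, ← mul_assoc, Units.mul_inv, one_mul,
      ← Complex.coe_smul, smul_smul]
    norm_num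

end CStar

/-! ### Ando's theorem by perturbation to the invertible, strict case. -/

section Ando

variable {H : Type*} [NormedAddCommGroup H] [InnerProductSpace ℂ H] [FiniteDimensional ℂ H]

theorem finite_spectrum (B : H →L[ℂ] H) : (spectrum ℂ B).Finite := by
  rw [ContinuousLinearMap.spectrum_eq]
  exact Module.End.finite_spectrum (B : H →ₗ[ℂ] H)

/-- Ando's theorem in finite dimensions. -/
theorem mem_andoSet [CompleteSpace H] {B : H →L[ℂ] H}
    (hB : ∀ x, ‖inner ℂ x (B x)‖ ≤ ‖x‖ ^ 2) : B ∈ andoSet (H →L[ℂ] H) := by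
  have : ProperSpace (H →L[ℂ] H) := FiniteDimensional.proper ℂ _
  -- Adding `t` makes `B` invertible for all small `t > 0`; dividing by `1 + 2t` rather than `1 + t`
  -- makes the numerical radius bound `(1 + t) / (1 + 2t)` strictly less than 1.
  set f : ℝ → H →L[ℂ] H := fun t => ((1 + 2 * t)⁻¹ : ℝ) • (B + t • (1 : H →L[ℂ] H)) with hf
  have hlim : Filter.Tendsto f (nhdsWithin 0 (Set.Ioi 0)) (nhds B) := by
    have h1 : ContinuousAt (fun t : ℝ => (1 + 2 * t)⁻¹) 0 :=
      ContinuousAt.inv₀ (by fun_prop) (by norm_num)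
    have h2 : ContinuousAt (fun t : ℝ => B + t • (1 : H →L[ℂ] H)) 0 := by fun_prop
    have : ContinuousAt f 0 := h1.smul h2
    have h2 := this.tendsto.mono_left (nhdsWithin_le_nhds (s := Set.Ioi 0))
    simpa [hf] using h2
  refine isClosed_andoSet.mem_of_tendsto hlim ?_
  have hfin : {t : ℝ | -(t : ℂ) ∈ spectrum ℂ B}.Finite :=
    (finite_spectrum B).preimage fun a _ b _ h => by simpa using h
  -- The point 0 is removed because `B` itself may be singular.
  have h1 : ∀ᶠ t in nhdsWithin (0 : ℝ) (Set.Ioi 0), t ∉ {t : ℝ | -(t : ℂ) ∈ spectrum ℂ B} \ {0} := by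
    have : ∀ᶠ t in nhds (0 : ℝ), t ∉ {t : ℝ | -(t : ℂ) ∈ spectrum ℂ B} \ {0} :=
      (hfin.subset Set.sdiff_subset).isClosed.isOpen_compl.mem_nhds (by simp)
    exact this.filter_mono nhdsWithin_le_nhds
  filter_upwards [h1, self_mem_nhdsWithin] with t ht ht0
  have ht0 : 0 < t := ht0
  have hu : IsUnit (B + t • (1 : H →L[ℂ] H)) := by
    have : -(t : ℂ) ∉ spectrum ℂ B := fun h => ht ⟨h, by simpa using ht0.ne'⟩
    rw [spectrum.notMem_iff] at this
    have h3 := this.neg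
    convert h3 using 1
    rw [Algebra.algebraMap_eq_smul_one, ← Complex.coe_smul]
    module
  have hfu : IsUnit (f t) := hu.smul (Units.mk0 ((1 + 2 * t)⁻¹ : ℝ) (by positivity))
  have hr : (1 + t) / (1 + 2 * t) < 1 := by rw [div_lt_one (by positivity)]; linarith
  obtain ⟨G, hG, hG2⟩ := exists_schurStep_fixed (B := f t) hr (fun x => by
    have e : inner ℂ x (f t x) = ((1 + 2 * t)⁻¹ : ℝ) * (inner ℂ x (B x) + t * (‖x‖ ^ 2 : ℝ)) := by
      have : f t x = (((1 + 2 * t)⁻¹ : ℝ) : ℂ) • (B x + (t : ℂ) • x) := by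
        rw [Complex.coe_smul, Complex.coe_smul]
        rfl
      rw [this, inner_smul_right, inner_add_right, inner_smul_right, inner_self_eq_norm_sq_to_K]
      push_cast
      rfl
    rw [e, norm_mul, Complex.norm_real, Real.norm_of_nonneg (by positivity), div_mul_eq_mul_div,
      div_eq_inv_mul]
    gcongr
    refine (norm_add_le _ _).trans ?_
    rw [norm_mul, Complex.norm_real, Complex.norm_real, Real.norm_of_nonneg ht0.le,
      Real.norm_of_nonneg (by positivity), add_mul, one_mul]
    gcongr
    exact hB x)
  exact mem_andoSet_of_isUnit hfu hG hG2

end Ando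

/-! ### Block operators and the explicit Douglas–Paulsen operator. -/

section Block

open ContinuousLinearMap

variable {H : Type*} [NormedAddCommGroup H] [InnerProductSpace ℂ H]

/-- The operator on `H ⊕ H` with a given block matrix. -/
noncomputable def blockOp (a b c d : H →L[ℂ] H) : WithLp 2 (H × H) →L[ℂ] WithLp 2 (H × H) :=
  (WithLp.prodContinuousLinearEquiv 2 ℂ H H).symm.toContinuousLinearMap ∘L
    ((a ∘L fst ℂ H H + b ∘L snd ℂ H H).prod (c ∘L fst ℂ H H + d ∘L snd ℂ H H)) ∘L
    (WithLp.prodContinuousLinearEquiv 2 ℂ H H).toContinuousLinearMap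

theorem blockOp_apply (a b c d : H →L[ℂ] H) (v : WithLp 2 (H × H)) :
    blockOp a b c d v = WithLp.toLp 2 (a v.fst + b v.snd, c v.fst + d v.snd) := rfl

theorem blockOp_mul (a b c d a' b' c' d' : H →L[ℂ] H) :
    blockOp a b c d * blockOp a' b' c' d' =
      blockOp (a * a' + b * c') (a * b' + b * d') (c * a' + d * c') (c * b' + d * d') := by
  ext v
  rw [mul_apply_eq_comp, blockOp_apply, blockOp_apply, blockOp_apply]
  apply WithLp.ofLp_injective
  simp only [add_apply, mul_apply_eq_comp]
  refine Prod.ext ?_ ?_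
  · simp; abel
  · simp; abel

theorem blockOp_one : blockOp (1 : H →L[ℂ] H) 0 0 1 = 1 := by
  ext v
  rw [blockOp_apply]
  apply WithLp.ofLp_injective
  refine Prod.ext ?_ ?_ <;> simp

theorem norm_blockOp_diag_le {a d : H →L[ℂ] H} {k : ℝ} (hk : 0 ≤ k) (ha : ‖a‖ ≤ k) (hd : ‖d‖ ≤ k) :
    ‖blockOp a 0 0 d‖ ≤ k := by
  refine opNorm_le_bound _ hk fun v => ?_
  refine le_of_sq_le_sq ?_ (by positivity)
  rw [mul_pow, WithLp.prod_norm_sq_eq_of_L2, WithLp.prod_norm_sq_eq_of_L2, blockOp_apply, mul_add,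
    ← mul_pow, ← mul_pow]
  simp only [zero_apply, add_zero, zero_add]
  gcongr
  · exact (a.le_opNorm _).trans (by gcongr)
  · exact (d.le_opNorm _).trans (by gcongr)

theorem blockOp_reflection_mul_self {s c : H →L[ℂ] H} (hcs : c * s = s * c)
    (h1 : c * c + s * s = 1) : blockOp s c c (-s) * blockOp s c c (-s) = 1 := by
  rw [blockOp_mul, ← blockOp_one, neg_mul_neg, mul_neg, neg_mul, hcs, add_neg_cancel, add_comm, h1]

theorem norm_blockOp_reflection_le [CompleteSpace H] {s c : H →L[ℂ] H} (hs : star s = s)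
    (hc : star c = c) (hcs : c * s = s * c) (h1 : c * c + s * s = 1) :
    ‖blockOp s c c (-s)‖ ≤ 1 := by
  apply norm_le_one_of_star_mul_self
  have hs' : ∀ x y, inner ℂ (s x) y = inner ℂ x (s y) := fun x y => by
    rw [← adjoint_inner_left, ← star_eq_adjoint, hs]
  have hc' : ∀ x y, inner ℂ (c x) y = inner ℂ x (c y) := fun x y => by
    rw [← adjoint_inner_left, ← star_eq_adjoint, hc]
  have h : blockOp s c c (-s) = star (blockOp s c c (-s)) := by
    rw [star_eq_adjoint, eq_adjoint_iff]
    intro x y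
    simp only [blockOp_apply, WithLp.prod_inner_apply, inner_add_left, inner_add_right, neg_apply,
      inner_neg_left, inner_neg_right, hs', hc', WithLp.fst, WithLp.snd]
    ring
  rw [← h, blockOp_reflection_mul_self hcs h1]

/-- Take `X = S D R` with `R`, `S` self-adjoint involutions, so the norms of `X` and `X⁻¹ = R D' S`
are controlled by the diagonal factors. On `(x, 0)` the second components `± (s W s - δ c W⋆ c) x`
of `X` and `δ X⁻¹` cancel, while the first ones agree and add up to `2 (c W s + δ s W⋆ c) x`. -/
theorem exists_douglasPaulsen_of_mem_andoSet [CompleteSpace H] {δ : ℝ} (hδ0 : 0 < δ) (hδ1 : δ < 1)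
    {B : H →L[ℂ] H} (hB : B ∈ andoSet (H →L[ℂ] H)) :
    ∃ X : WithLp 2 (H × H) →L[ℂ] WithLp 2 (H × H), IsDouglasPaulsen δ X ∧
      ∀ x, joukowski δ X (inl H x) = inl H ((B + (δ : ℂ) • star B) x) := by
  obtain ⟨W, c, s, hW1, hW2, hc, hs, hcs, h1, rfl⟩ := hB
  set R := blockOp s c c (-s) with hR
  set S := blockOp c s s (-c) with hS
  set D := blockOp W 0 0 ((δ : ℂ) • star W) with hD
  set D' := blockOp (star W) 0 0 ((δ : ℂ)⁻¹ • W) with hD'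
  have h1' : s * s + c * c = 1 := by rw [add_comm, h1]
  have hδ : (δ : ℂ) ≠ 0 := by exact_mod_cast hδ0.ne'
  have hRR : R * R = 1 := blockOp_reflection_mul_self hcs h1
  have hSS : S * S = 1 := blockOp_reflection_mul_self hcs.symm h1'
  have hRn : ‖R‖ ≤ 1 := norm_blockOp_reflection_le hs hc hcs h1
  have hSn : ‖S‖ ≤ 1 := norm_blockOp_reflection_le hc hs hcs.symm h1'
  have hDD' : D * D' = 1 := by
    rw [hD, hD', blockOp_mul, ← blockOp_one]; simp [hW1, hW2, smul_smul, hδ, -Complex.coe_smul]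
  have hD'D : D' * D = 1 := by
    rw [hD, hD', blockOp_mul, ← blockOp_one]; simp [hW1, hW2, smul_smul, hδ, -Complex.coe_smul]
  have hWn : ‖W‖ ≤ 1 := norm_le_one_of_star_mul_self hW1
  have hWn' : ‖star W‖ ≤ 1 := by rwa [norm_star]
  have hδi : 1 ≤ 1 / δ := by rw [le_div_iff₀ hδ0]; linarith
  have hDn : ‖D‖ ≤ 1 := by
    refine norm_blockOp_diag_le zero_le_one hWn ?_
    rw [norm_smul, Complex.norm_real, Real.norm_of_nonneg hδ0.le]
    nlinarith
  have hDn' : ‖D'‖ ≤ 1 / δ := by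
    refine norm_blockOp_diag_le (by positivity) (hWn'.trans hδi) ?_
    rw [norm_smul, norm_inv, Complex.norm_real, Real.norm_of_nonneg hδ0.le, one_div]
    exact mul_le_of_le_one_right (by positivity) hWn
  have hX1 : S * D * R * (R * D' * S) = 1 := by
    calc S * D * R * (R * D' * S) = S * (D * (R * R) * D') * S := by noncomm_ring
      _ = 1 := by rw [hRR, mul_one, hDD', mul_one, hSS]
  have hX2 : R * D' * S * (S * D * R) = 1 := by
    calc R * D' * S * (S * D * R) = R * (D' * (S * S) * D) * R := by noncomm_ring
      _ = 1 := by rw [hSS, mul_one, hD'D, mul_one, hRR]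
  have hinv : Ring.inverse (S * D * R) = R * D' * S := inverse_eq_of_mul_eq_one hX1 hX2
  have bound : ∀ (P Q T : WithLp 2 (H × H) →L[ℂ] WithLp 2 (H × H)) (k : ℝ), ‖P‖ ≤ 1 → ‖T‖ ≤ 1 →
      ‖Q‖ ≤ k → ‖P * Q * T‖ ≤ k := by
    intro P Q T k hP hT hQ
    calc ‖P * Q * T‖ ≤ ‖P‖ * ‖Q‖ * ‖T‖ := norm_mul₃_le
      _ ≤ 1 * ‖Q‖ * 1 := by gcongr
      _ ≤ k := by linarith
  refine ⟨S * D * R, ⟨⟨⟨_, _, hX1, hX2⟩, rfl⟩, bound _ _ _ _ hSn hRn hDn, ?_⟩, fun x => ?_⟩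
  · rw [hinv]; exact bound _ _ _ _ hRn hSn hDn'
  · have hx : inl H x = WithLp.toLp 2 (x, 0) := rfl
    have hy : inl H (((2 : ℂ) • (c * W * s) + (δ : ℂ) • star ((2 : ℂ) • (c * W * s))) x) =
      WithLp.toLp 2 (((2 : ℂ) • (c * W * s) + (δ : ℂ) • star ((2 : ℂ) • (c * W * s))) x, 0) := rfl
    rw [joukowski, hinv, hx, hy]
    simp only [star_smul, star_mul, hc, hs, add_apply, smul_apply, mul_apply_eq_comp, hR, hS, hD,
      hD', blockOp_apply]
    apply WithLp.ofLp_injective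
    refine Prod.ext ?_ ?_
    · simp [smul_smul, hδ, -Complex.coe_smul]
      module
    · simp [smul_smul, hδ, -Complex.coe_smul]

end Block

/-! ### Restrictions, change of universe, and the dilation of `T`. -/

section Main

open ContinuousLinearMap

variable {H : Type*} [NormedAddCommGroup H] [InnerProductSpace ℂ H]

theorem numericalRange_subset_of_isRestriction {K : Type*} [NormedAddCommGroup K]
    [InnerProductSpace ℂ K] {ι : H →ₗᵢ[ℂ] K} {T : H →L[ℂ] H} {A : K →L[ℂ] K}
    (h : IsRestriction ι T A) : numericalRange T ⊆ numericalRange A := by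
  rintro _ ⟨x, hx, rfl⟩
  exact ⟨ι x, by rw [ι.norm_map, hx], by rw [h.2, ι.inner_map_map]⟩

/-- A Douglas–Paulsen dilation on a finite-dimensional space has a copy in every universe. -/
theorem exists_douglasPaulsen_transport {K : Type*} [NormedAddCommGroup K] [InnerProductSpace ℂ K]
    [FiniteDimensional ℂ K] {δ : ℝ} {ι : H →ₗᵢ[ℂ] K} {T : H →L[ℂ] H} {X : K →L[ℂ] K}
    (hX : IsDouglasPaulsen δ X) (hT : IsRestriction ι T (joukowski δ X)) :
    ∃ (L : Type v) (_ : NormedAddCommGroup L) (_ : InnerProductSpace ℂ L) (_ : CompleteSpace L)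
      (ι' : H →ₗᵢ[ℂ] L) (Y : L →L[ℂ] L), IsDouglasPaulsen δ Y ∧
        IsRestriction ι' T (joukowski δ Y) := by
  -- Lifting the index type places the coordinate space in the universe `v`; conjugation by `e`
  -- carries everything over.
  let e : K ≃ₗᵢ[ℂ] EuclideanSpace ℂ (ULift.{v} (Fin (Module.finrank ℂ K))) :=
    (stdOrthonormalBasis ℂ K).reindex Equiv.ulift.symm |>.repr
  obtain ⟨⟨u, rfl⟩, hn, hi⟩ := hX
  let φ : (K →L[ℂ] K) → _ := fun A =>
    e.toContinuousLinearEquiv.toContinuousLinearMap ∘L A ∘L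
      e.symm.toContinuousLinearEquiv.toContinuousLinearMap
  have φ_apply : ∀ A y, φ A y = e (A (e.symm y)) := fun A y => rfl
  have φn : ∀ A, ‖φ A‖ ≤ ‖A‖ := fun A => by
    refine opNorm_le_bound _ (norm_nonneg _) fun y => ?_
    rw [φ_apply, e.norm_map]
    simpa using A.le_opNorm (e.symm y)
  have φm : ∀ A A', A * A' = 1 → φ A * φ A' = 1 := fun A A' h => by
    ext1 y
    rw [mul_apply_eq_comp, φ_apply, φ_apply, e.symm_apply_apply, ← mul_apply_eq_comp, h]
    simp
  have hinv : Ring.inverse (φ u) = φ ↑u⁻¹ :=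
    inverse_eq_of_mul_eq_one (φm _ _ u.mul_inv) (φm _ _ u.inv_mul)
  rw [Ring.inverse_unit] at hi
  have hT2 : ∀ x, joukowski δ (φ u) (e (ι x)) = e (ι (T x)) := fun x => by
    rw [← hT.2, joukowski, joukowski, hinv, Ring.inverse_unit]
    simp [φ_apply, -Complex.coe_smul]
  refine ⟨_, inferInstance, inferInstance, inferInstance, e.toLinearIsometry.comp ι, φ u,
    ⟨⟨⟨φ u, φ ↑u⁻¹, φm _ _ u.mul_inv, φm _ _ u.inv_mul⟩, rfl⟩, (φn _).trans hn, ?_⟩, ?_, hT2⟩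
  · rw [hinv]; exact (φn _).trans hi
  · rintro _ ⟨x, rfl⟩
    exact ⟨T x, (hT2 x).symm⟩

theorem exists_douglasPaulsen_dilation [FiniteDimensional ℂ H] {δ : ℝ} (hδ0 : 0 < δ) (hδ1 : δ < 1) {T : H →L[ℂ] H}
    (hT : numericalRange T ⊆ ellipse δ) :
    ∃ X : WithLp 2 (H × H) →L[ℂ] WithLp 2 (H × H), IsDouglasPaulsen δ X ∧
      IsRestriction (inl H) T (joukowski δ X) := by
  have : CompleteSpace H := FiniteDimensional.complete ℂ H
  have hd : 0 < 1 - δ ^ 2 := by nlinarith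
  have hdc : (1 - (δ : ℂ) ^ 2) ≠ 0 := by exact_mod_cast hd.ne'
  -- This solves `B + δ B⋆ = T`. On unit vectors its form is `(z - δ z̄) / (1 - δ²)` with `z ∈
  -- W(T)`, so the ellipse condition bounds it by 1.
  set B : H →L[ℂ] H := ((1 - (δ : ℂ) ^ 2)⁻¹) • (T - (δ : ℂ) • star T) with hBdef
  have hTB : B + (δ : ℂ) • star B = T := by
    have h2 : star B = ((1 - (δ : ℂ) ^ 2)⁻¹) • (star T - (δ : ℂ) • T) := by
      simp [hBdef, star_smul]
    rw [h2, hBdef, smul_comm (δ : ℂ), ← smul_add]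
    rw [inv_smul_eq_iff₀ hdc]
    module
  have hB : ∀ x, ‖inner ℂ x (B x)‖ ≤ ‖x‖ ^ 2 := by
    intro x
    have key : ∀ y : H, ‖y‖ = 1 → ‖inner ℂ y (B y)‖ ≤ 1 := by
      intro y hy
      have h1 := norm_le_of_mem_ellipse hδ0 hδ1 (hT ⟨y, hy, rfl⟩)
      have h2 : inner ℂ y (B y) = (1 - (δ : ℂ) ^ 2)⁻¹ *
          (inner ℂ y (T y) - δ * (starRingEnd ℂ) (inner ℂ y (T y))) := by
        rw [inner_conj_symm, hBdef, smul_apply, inner_smul_right, sub_apply, inner_sub_right,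
          smul_apply, inner_smul_right, star_eq_adjoint, adjoint_inner_right]
      have h3 : ‖(1 - (δ : ℂ) ^ 2)⁻¹‖ = (1 - δ ^ 2)⁻¹ := by
        rw [norm_inv]
        norm_cast
        rw [Real.norm_of_nonneg hd.le]
      rw [h2, norm_mul, h3, inv_mul_le_iff₀ hd, mul_one]
      exact h1
    rcases eq_or_ne x 0 with rfl | hx
    · simp
    · have hx' : ‖x‖ ≠ 0 := norm_ne_zero_iff.mpr hx
      have h := key (((‖x‖ : ℂ)⁻¹) • x) (by simp [norm_smul, hx'])
      rw [map_smul, inner_smul_left, inner_smul_right, norm_mul, norm_mul] at h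
      simp only [RCLike.norm_conj, norm_inv, Complex.norm_real, norm_norm] at h
      rw [inv_mul_le_iff₀ (by positivity), inv_mul_le_iff₀ (by positivity)] at h
      linarith
  obtain ⟨X, hX, h⟩ := exists_douglasPaulsen_of_mem_andoSet hδ0 hδ1 (mem_andoSet hB)
  rw [hTB] at h
  refine ⟨X, hX, ?_, h⟩
  rintro _ ⟨x, rfl⟩
  exact ⟨T x, (h x).symm⟩

end Main

end EllipseRange

theorem mainTheorem6 (δ : ℝ) (hδ0 : 0 < δ) (hδ1 : δ < 1) :
    (∀ (H : Type u) [NormedAddCommGroup H] [InnerProductSpace ℂ H] [FiniteDimensional ℂ H]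
        (T : H →L[ℂ] H),
      (EllipseRange.numericalRange T ⊆ EllipseRange.ellipse δ ↔
        ∃ X : WithLp 2 (H × H) →L[ℂ] WithLp 2 (H × H),
          EllipseRange.IsDouglasPaulsen δ X ∧
          EllipseRange.IsRestriction (EllipseRange.inl H) T (EllipseRange.joukowski δ X)) ∧
      (EllipseRange.numericalRange T ⊆ EllipseRange.ellipse δ ↔
        ∃ (K : Type v) (_ : NormedAddCommGroup K) (_ : InnerProductSpace ℂ K)
          (_ : CompleteSpace K) (ι : H →ₗᵢ[ℂ] K) (X : K →L[ℂ] K),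
          EllipseRange.IsDouglasPaulsen δ X ∧
          EllipseRange.IsRestriction ι T (EllipseRange.joukowski δ X))) ∧
    (∀ (H : Type u) [NormedAddCommGroup H] [InnerProductSpace ℂ H] [FiniteDimensional ℂ H]
        (X : H →L[ℂ] H), EllipseRange.IsDouglasPaulsen δ X →
      EllipseRange.numericalRange (EllipseRange.joukowski δ X) ⊆ EllipseRange.ellipse δ) := by
  refine ⟨fun H _ _ _ T => ⟨⟨EllipseRange.exists_douglasPaulsen_dilation hδ0 hδ1, ?_⟩, ?_, ?_⟩,
    fun H _ _ _ X hX => ?_⟩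
  · rintro ⟨X, hX, hT⟩
    have : CompleteSpace H := FiniteDimensional.complete ℂ H
    exact (EllipseRange.numericalRange_subset_of_isRestriction hT).trans
      (EllipseRange.numericalRange_joukowski_subset hδ0 hδ1 hX)
  · intro h
    obtain ⟨X, hX, hT⟩ := EllipseRange.exists_douglasPaulsen_dilation hδ0 hδ1 h
    exact EllipseRange.exists_douglasPaulsen_transport hX hT
  · rintro ⟨K, _, _, _, ι, X, hX, hT⟩
    exact (EllipseRange.numericalRange_subset_of_isRestriction hT).trans
      (EllipseRange.numericalRange_joukowski_subset hδ0 hδ1 hX)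
  · have : CompleteSpace H := FiniteDimensional.complete ℂ H
    exact EllipseRange.numericalRange_joukowski_subset hδ0 hδ1 hX
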